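/- Products are the points of $[0,1]$, and assortments are the Borel sets $S\subseteq[0,1]$ (there is no capacity constraint). Let $w:[0,1]\to[0,1]$ be continuous, and continuously differentiable on $(0,1)$ with $\inf_{x\in(0,1)}w'(x)>0$. Let $\overline v>\underline v>0$ with $\overline v>w(0)/\int_0^1(w(x)-w(0))\,dx$, let $L\ge 0$, and let $\mathcal V$ be the class of all functions $v$ on $[0,1]$ with $\underline v\le v\le\overline v$ that are differentiable on $(0,1)$ with $|v'|\le L$ there. If the preference function is $v\in\mathcal V$, a customer who is offered $S$ makes a choice $X^S\in[0,1]\cup\{\emptyset\}$ with $P(X^S\in A)=\int_A v\,dx\,/\,(1+\int_S v\,dx)$ for Borel $A\subseteq S$ and $P(X^S=\emptyset)=1/(1+\int_S v\,dx)$. The expected revenue is $r(S,v)=\int_S v w\,dx\,/\,(1+\int_S v\,dx)$. A policy $\pi$ chooses, in each period $t$, the assortment $S_t$ as a (measurable) function of $S_1,X_1,\dots,S_{t-1},X_{t-1}$, where $X_t$, given the past and $S_t=S$, is distributed as $X^S$. Its worst-case regret over $T$ periods is $$\Delta_\pi(T)=\sup_{v\in\mathcal V}\ \sum_{t=1}^T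 \mathbb E_\pi\Big[\max_{S} r(S,v)-r(S_t,v)\Big].$$ Then there is a constant $C>0$ (depending only on $w,\underline v,\overline v,L$) such that, for all policies $\pi$ and all $T\ge 2$, $$\Delta_\pi(T)\ \ge\ C\log T .$$ -/

import Mathlib

open MeasureTheory ProbabilityTheory Set
open scoped ENNReal unitInterval

noncomputable section

namespace ContinuousAssortment

/-- An assortment: a Borel subset of the product space `[0,1]`.  In the uncapacitated case `c = 1`
the capacity constraint `vol S ≤ c` is void, so that these are all the feasible assortments. -/
structure Assortment where
  carrier : Set I
  measurableSet_carrier : MeasurableSet carrier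

/-- What a customer does: she buys a product `Sum.inl x` with `x ∈ [0,1]`, or makes no purchase,
`Sum.inr ()`. -/
abbrev Purchase : Type := I ⊕ Unit

/-- The σ-algebra on assortments generated by the maps `S ↦ vol (S ∩ A)`, `A ⊆ [0,1]` Borel.
It is the coarsest one that makes all expected revenues and choice probabilities measurable in the
offered assortment, so that measurability with respect to it is a minimal requirement. -/
instance : MeasurableSpace Assortment :=
  ⨆ A : {A : Set I // MeasurableSet A},
    MeasurableSpace.comap (fun S : Assortment => (volume (S.carrier ∩ A.1) : ℝ≥0∞)) inferInstance

/-- Law of the choice `X^S` of a customer with preference function `v` who is offered `S`: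
`P(X^S ∈ A) = ∫_A v / (1 + ∫_S v)` for Borel `A ⊆ S`, and `P(X^S = ∅) = 1 / (1 + ∫_S v)`. -/
def choiceLaw (v : ℝ → ℝ) (S : Assortment) : Measure Purchase :=
  (1 + ∫⁻ x in S.carrier, ENNReal.ofReal (v (x : ℝ)))⁻¹ •
    (((volume.restrict S.carrier).withDensity (fun x : I => ENNReal.ofReal (v (x : ℝ)))).map Sum.inl
      + Measure.dirac (Sum.inr ()))

theorem measurable_volume_inter {A : Set I} (hA : MeasurableSet A) :
    Measurable (fun S : Assortment => (volume (S.carrier ∩ A) : ℝ≥0∞)) := by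
  rw [measurable_iff_comap_le]
  exact le_iSup (fun A : {A : Set I // MeasurableSet A} =>
    MeasurableSpace.comap (fun S : Assortment => (volume (S.carrier ∩ A.1) : ℝ≥0∞)) inferInstance)
    ⟨A, hA⟩

theorem measurable_setLIntegral (f : I → ℝ≥0∞) :
    Measurable (fun S : Assortment => ∫⁻ x in S.carrier, f x) := by
  obtain ⟨g, hg, -, hfg⟩ := exists_measurable_le_forall_setLIntegral_eq (volume : Measure I) f
  simp_rw [hfg]
  have hm : Measurable (fun S : Assortment => (volume.restrict S.carrier : Measure I)) := by
    refine Measure.measurable_of_measurable_coe _ fun A hA => ?_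
    simp_rw [Measure.restrict_apply hA, inter_comm A]
    exact measurable_volume_inter hA
  exact (Measure.measurable_lintegral hg).comp hm

theorem measurable_choiceLaw (v : ℝ → ℝ) : Measurable (choiceLaw v) := by
  refine Measure.measurable_of_measurable_coe _ fun B hB => ?_
  have hB' : MeasurableSet (Sum.inl ⁻¹' B : Set I) := measurable_inl hB
  simp only [choiceLaw, Measure.smul_apply, Measure.add_apply, smul_eq_mul,
    Measure.map_apply measurable_inl hB, withDensity_apply _ hB',
    Measure.restrict_restrict hB']
  refine ((measurable_setLIntegral _).const_add 1).inv.mul (Measurable.add_const ?_ _)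
  have h : ∀ S : Assortment, ∫⁻ x in (Sum.inl ⁻¹' B) ∩ S.carrier, ENNReal.ofReal (v (x : ℝ))
      = ∫⁻ x in S.carrier, (Sum.inl ⁻¹' B : Set I).indicator (fun x => ENNReal.ofReal (v (x : ℝ))) x := by
    intro S
    rw [lintegral_indicator hB', Measure.restrict_restrict hB']
  simp_rw [h]
  exact measurable_setLIntegral _

/-- The choice laws as a kernel from assortments to purchases. -/
def choiceKernel (v : ℝ → ℝ) : Kernel Assortment Purchase :=
  ⟨choiceLaw v, measurable_choiceLaw v⟩

/-- For an integrable preference function the choice laws are probability measures. -/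
theorem isMarkovKernel_choiceKernel (v : ℝ → ℝ)
    (hv : ∫⁻ x : I, ENNReal.ofReal (v (x : ℝ)) ≠ ∞) : IsMarkovKernel (choiceKernel v) := by
  refine ⟨fun S => ⟨?_⟩⟩
  have hS : ∫⁻ x in S.carrier, ENNReal.ofReal (v (x : ℝ)) ≠ ∞ :=
    ne_top_of_le_ne_top hv (setLIntegral_le_lintegral _ _)
  change choiceLaw v S univ = 1
  simp only [choiceLaw, Measure.smul_apply, Measure.add_apply, smul_eq_mul,
    Measure.map_apply measurable_inl MeasurableSet.univ, preimage_univ,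
    withDensity_apply _ MeasurableSet.univ, Measure.restrict_univ, measure_univ]
  rw [add_comm _ (1 : ℝ≥0∞)]
  exact ENNReal.inv_mul_cancel (by simp) (by simp [hS])

/-- The sales data that the rules `π` (`π t` chooses the assortment of period `t + 1` from the
assortments and purchases of periods `1, …, t`) generate when the customers' purchases are `x`. -/
def salesData (π : (t : ℕ) → (Fin t → Assortment × Purchase) → Assortment) :
    (t : ℕ) → (Fin t → Purchase) → (Fin t → Assortment × Purchase)
  | 0, _ => Fin.elim0
  | t + 1, x =>
    Fin.snoc (α := fun _ => Assortment × Purchase) (salesData π t (Fin.init x))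
      (π t (salesData π t (Fin.init x)), x (Fin.last t))

/-- A policy: `rule t` maps the assortments and purchases of periods `1, …, t` to the assortment
offered in period `t + 1`.  The offered assortments are required to depend measurably on the
purchases (only the first `T` rules matter for a horizon `T`, so that a policy with horizon `T`
is the restriction of such a sequence). -/
structure Policy where
  rule : (t : ℕ) → (Fin t → Assortment × Purchase) → Assortment
  measurable_rule : ∀ t, Measurable fun x : Fin t → Purchase => rule t (salesData rule t x)

/-- The assortment `S_{t+1}` offered in period `t + 1`, as a function of the first `t` purchases. -/
def Policy.offer (π : Policy) (t : ℕ) (x : Fin t → Purchase) : Assortment :=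
  π.rule t (salesData π.rule t x)

/-- The joint law of the purchases `(X_1, …, X_t)` under policy `π` and preference function `v`:
given the first `t` purchases, `X_{t+1}` has the law of `X^S` with `S = S_{t+1}`. -/
def purchaseLaw (v : ℝ → ℝ) (π : Policy) : (t : ℕ) → Measure (Fin t → Purchase)
  | 0 => Measure.dirac Fin.elim0
  | t + 1 =>
    ((purchaseLaw v π t) ⊗ₘ ((choiceKernel v).comap (π.offer t) (π.measurable_rule t))).map
      (fun p => Fin.snoc (α := fun _ => Purchase) p.1 p.2)

/-- The expected revenue `r(S, v)`, with marginal revenue function `w`. -/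
def revenue (w v : ℝ → ℝ) (S : Assortment) : ℝ :=
  (∫ x in S.carrier, v (x : ℝ) * w (x : ℝ)) / (1 + ∫ x in S.carrier, v (x : ℝ))

/-- The optimal expected revenue. -/
def optRevenue (w v : ℝ → ℝ) : ℝ := ⨆ S : Assortment, revenue w v S

/-- The regret `Δ_π(T, v)`. -/
def regret (w : ℝ → ℝ) (π : Policy) (T : ℕ) (v : ℝ → ℝ) : ℝ :=
  ∑ t ∈ Finset.range T,
    ∫ x, (optRevenue w v - revenue w v (π.offer t x)) ∂(purchaseLaw v π t)

/-- The worst-case regret `Δ_π(T)` over a class `V` of preference functions. -/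
def worstCaseRegret (w : ℝ → ℝ) (V : Set (ℝ → ℝ)) (π : Policy) (T : ℕ) : ℝ :=
  ⨆ v : V, regret w π T v

/-- The standing assumptions on the marginal revenue function `w` (only its values on `[0,1]`
matter): continuous with values in `[0,1]`, and continuously differentiable with a derivative that
is bounded away from zero. -/
structure IsMarginalRevenue (w : ℝ → ℝ) : Prop where
  continuousOn : ContinuousOn w (Icc 0 1)
  mapsTo : MapsTo w (Icc 0 1) (Icc 0 1)
  contDiffOn : ContDiffOn ℝ 1 w (Ioo 0 1)
  deriv_pos : ∃ k > 0, ∀ x ∈ Ioo (0 : ℝ) 1, k ≤ deriv w x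

/-- The class of preference functions with values in `[vmin, vmax]` on `[0,1]` that are
differentiable on `(0,1)` with derivative bounded by `L`. -/
def prefClass (vmin vmax L : ℝ) : Set (ℝ → ℝ) :=
  {v | (∀ y ∈ Icc (0 : ℝ) 1, vmin ≤ v y ∧ v y ≤ vmax) ∧
    DifferentiableOn ℝ v (Ioo 0 1) ∧ ∀ y ∈ Ioo (0 : ℝ) 1, |deriv v y| ≤ L}

end ContinuousAssortment

end

open ContinuousAssortment

/-!
Constant preference functions already force the logarithmic regret; they belong to the class for
every `L ≥ 0`.

For the constant preference `p` the optimal assortment is an upper interval `[y, 1]`, where the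
threshold `y` solves the indifference equation `p ∫_y^1 (w - w y) = w y`. Solved for `p`, this is a
curve `y ↦ θ y` of preferences, and the lower bound on `vmax` is what makes the curve pass through
`(vmin, vmax)` at an interior `y`; there it is Lipschitz, because `w` is `C¹`
(`exists_lipschitz_threshold_curve`). As `w` grows at least linearly, a rearrangement argument shows
that under `θ y` an assortment `S` loses at least a multiple of `(1 - vol S - y)²`
(`sq_le_sub_revenue`). So a policy of small regret estimates `y` by `1 - vol S_t`.

Such an estimate cannot be good. Under the constant preferences `p` and `q`, one sale has a law with
`χ²`-divergence at most `(q - p)² / vmin`, whatever is offered, and the bounds on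
`1 + χ²` multiply along the periods (`chiSqBound_purchaseLaw`). Hence thresholds at distance `δ` of order `1 / √(t + 1)`
cannot be told apart from `t` sales, and by Le Cam's two-point argument their regrets in period
`t + 1` add up to at least a multiple of `δ²`, that is of `1 / (t + 1)`
(`sq_le_periodRegret_add`).

The pairs change with `t`, so no single pair serves all periods. The regret is therefore averaged
over a fine grid of thresholds: for each `t` at least half of the grid points are the lower end
of a pair at the right distance (`mul_le_sum_of_le_add_shift`), so that the average regret
in period `t + 1` is at least a multiple of `1 / (t + 1)`. Summation over `t` gives `log T`, and the
supremum is at least the average.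
-/

namespace ContinuousAssortment

/-! ### Chi-square bounds for the sales data -/

/-- `1 + χ²(Q ‖ P) ≤ K`, in the dual form `(∫ f dQ)² ≤ K ∫ f² dP`, tested on `0 ≤ f ≤ 1`.
No density of `Q` with respect to `P` has to be constructed in this form. -/
def ChiSqBound {Ω : Type*} [MeasurableSpace Ω] (P Q : Measure Ω) (K : ℝ≥0∞) : Prop :=
  ∀ f : Ω → ℝ≥0∞, Measurable f → (∀ x, f x ≤ 1) →
    (∫⁻ x, f x ∂Q) ^ 2 ≤ K * ∫⁻ x, f x ^ 2 ∂P

theorem sq_lintegral_le {α : Type*} [MeasurableSpace α] (μ : Measure α) {f : α → ℝ≥0∞}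
    (hf : Measurable f) : (∫⁻ x, f x ∂μ) ^ 2 ≤ μ univ * ∫⁻ x, f x ^ 2 ∂μ := by
  have h := ENNReal.lintegral_mul_le_Lp_mul_Lq μ Real.HolderConjugate.two_two
    (f := fun _ => 1) (g := f) aemeasurable_const hf.aemeasurable
  simp only [Pi.mul_apply, one_mul, ENNReal.rpow_ofNat, one_pow, lintegral_const] at h
  calc (∫⁻ x, f x ∂μ) ^ 2
      ≤ (μ univ ^ (1 / 2 : ℝ) * (∫⁻ x, f x ^ 2 ∂μ) ^ (1 / 2 : ℝ)) ^ 2 := by gcongr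
    _ = μ univ * ∫⁻ x, f x ^ 2 ∂μ := by
        rw [mul_pow, ← ENNReal.rpow_mul_natCast, ← ENNReal.rpow_mul_natCast]
        norm_num

/-- The one-period `χ²`-bound in numbers: `m` is the volume of the assortment, `B` and `D` are the
integrals of `f` and `f²` over it, and `E` is the value of `f` at no purchase. -/
theorem chiSq_real_bound {c p q m B D E : ℝ} (hc : 0 < c) (hp : c ≤ p) (hq : 0 ≤ q)
    (hm : 0 ≤ m) (hm1 : m ≤ 1) (hD : 0 ≤ D) (hBD : B ^ 2 ≤ m * D) :
    ((q * B + E) / (1 + q * m)) ^ 2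
      ≤ (1 + (q - p) ^ 2 / c) * ((p * D + E ^ 2) / (1 + p * m)) := by
  have hp0 : 0 < p := hc.trans_le hp
  have h1 : 2 * (p * q * B * E) ≤ q ^ 2 * m * E ^ 2 + p ^ 2 * D := by
    have h2 : p ^ 2 * q ^ 2 * E ^ 2 * B ^ 2 ≤ p ^ 2 * q ^ 2 * E ^ 2 * (m * D) := by gcongr
    refine le_of_sq_le_sq ?_ (by positivity)
    nlinarith [sq_nonneg (q ^ 2 * m * E ^ 2 - p ^ 2 * D)]
  have h3 : p * (q * B + E) ^ 2 ≤ (q ^ 2 * m + p) * (p * D + E ^ 2) := by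
    have h4 : q ^ 2 * p * B ^ 2 ≤ q ^ 2 * p * (m * D) := by gcongr
    nlinarith
  have h5 : (q ^ 2 * m + p) * (1 + p * m) ≤ p * ((1 + q * m) ^ 2 * (1 + (q - p) ^ 2 / c)) := by
    have h6 : m * (q - p) ^ 2 ≤ p * ((1 + q * m) ^ 2 * ((q - p) ^ 2 / c)) := by
      have h7 : (q - p) ^ 2 ≤ p * ((q - p) ^ 2 / c) := by
        rw [mul_div_assoc', le_div_iff₀ hc, mul_comm]
        gcongr
      have h8 : (1 : ℝ) ≤ (1 + q * m) ^ 2 := one_le_pow₀ (by nlinarith)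
      calc m * (q - p) ^ 2 ≤ (1 + q * m) ^ 2 * (p * ((q - p) ^ 2 / c)) := by
            gcongr
            exact hm1.trans h8
        _ = _ := by ring
    nlinarith
  have hm' : 0 < 1 + p * m := by positivity
  rw [div_pow, mul_div_assoc', div_le_div_iff₀ (by positivity) hm']
  refine le_of_mul_le_mul_left ?_ hp0
  calc p * ((q * B + E) ^ 2 * (1 + p * m)) = p * (q * B + E) ^ 2 * (1 + p * m) := by ring
    _ ≤ (q ^ 2 * m + p) * (p * D + E ^ 2) * (1 + p * m) := by gcongr
    _ = (q ^ 2 * m + p) * (1 + p * m) * (p * D + E ^ 2) := by ring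
    _ ≤ p * ((1 + q * m) ^ 2 * (1 + (q - p) ^ 2 / c)) * (p * D + E ^ 2) := by gcongr
    _ = _ := by ring

theorem measurable_snoc (t : ℕ) : Measurable (fun p : (Fin t → Purchase) × Purchase =>
    (Fin.snoc (α := fun _ => Purchase) p.1 p.2 : Fin (t + 1) → Purchase)) := by
  refine measurable_pi_lambda _ fun i => ?_
  refine Fin.lastCases ?_ (fun j => ?_) i
  · simpa using measurable_snd
  · simp only [Fin.snoc_castSucc]
    exact (measurable_pi_apply (X := fun _ : Fin t => Purchase) j).comp (measurable_fst (β := Purchase))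

theorem lintegral_choiceLaw_const (p : ℝ) (S : Assortment) {f : Purchase → ℝ≥0∞}
    (hf : Measurable f) : ∫⁻ z, f z ∂choiceLaw (fun _ => p) S
      = (1 + ENNReal.ofReal p * volume S.carrier)⁻¹
        * (ENNReal.ofReal p * (∫⁻ x in S.carrier, f (Sum.inl x)) + f (Sum.inr ())) := by
  have hf' : Measurable fun x : I => f (Sum.inl x) := hf.comp measurable_inl
  rw [choiceLaw, lintegral_smul_measure, lintegral_add_measure, lintegral_map hf measurable_inl,
    lintegral_dirac' _ hf, withDensity_const, lintegral_smul_measure, setLIntegral_const]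
  simp only [smul_eq_mul]

theorem Policy.measurable_offer (π : Policy) (t : ℕ) : Measurable (π.offer t) :=
  π.measurable_rule t

theorem purchaseLaw_succ (v : ℝ → ℝ) (π : Policy) (t : ℕ) : purchaseLaw v π (t + 1)
    = ((purchaseLaw v π t) ⊗ₘ ((choiceKernel v).comap (π.offer t) (π.measurable_offer t))).map
      (fun p => Fin.snoc (α := fun _ => Purchase) p.1 p.2) := rfl

theorem isProbabilityMeasure_purchaseLaw (v : ℝ → ℝ)
    (hv : ∫⁻ x : I, ENNReal.ofReal (v (x : ℝ)) ≠ ∞) (π : Policy) (t : ℕ) :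
    IsProbabilityMeasure (purchaseLaw v π t) := by
  have := isMarkovKernel_choiceKernel v hv
  induction t with
  | zero => exact Measure.dirac.isProbabilityMeasure
  | succ t ih =>
    rw [purchaseLaw_succ]
    exact Measure.isProbabilityMeasure_map (measurable_snoc t).aemeasurable

theorem lintegral_purchaseLaw_succ (v : ℝ → ℝ) (hv : ∫⁻ x : I, ENNReal.ofReal (v (x : ℝ)) ≠ ∞)
    (π : Policy) (t : ℕ) {f : (Fin (t + 1) → Purchase) → ℝ≥0∞}
    (hf : Measurable f) : ∫⁻ x, f x ∂purchaseLaw v π (t + 1)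
      = ∫⁻ x, ∫⁻ z, f (Fin.snoc (α := fun _ => Purchase) x z) ∂choiceLaw v (π.offer t x)
          ∂purchaseLaw v π t := by
  have := isMarkovKernel_choiceKernel v hv
  have := isProbabilityMeasure_purchaseLaw v hv π t
  rw [purchaseLaw_succ, lintegral_map hf (measurable_snoc t)]
  exact Measure.lintegral_compProd (hf.comp (measurable_snoc t))

theorem lintegral_ofReal_const_ne_top (p : ℝ) : ∫⁻ _ : I, ENNReal.ofReal p ≠ ∞ := by simp

/-- One customer: the `χ²`-divergence of the choice laws is at most `(q - p)² / c`,
whatever assortment is offered. -/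
theorem chiSqBound_choiceLaw {c p q : ℝ} (hc : 0 < c) (hp : c ≤ p) (hq : c ≤ q) (S : Assortment) :
    ChiSqBound (choiceLaw (fun _ => p) S) (choiceLaw (fun _ => q) S)
      (ENNReal.ofReal (1 + (q - p) ^ 2 / c)) := by
  intro f hf hf1
  have hp0 : 0 < p := hc.trans_le hp
  have hq0 : 0 < q := hc.trans_le hq
  have hm1 : volume S.carrier ≤ 1 := prob_le_one
  have hB1 : ∫⁻ x in S.carrier, f (Sum.inl x) ≤ 1 :=
    (setLIntegral_mono' S.measurableSet_carrier fun x _ => hf1 _).trans (by simpa using hm1)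
  have hD1 : ∫⁻ x in S.carrier, f (Sum.inl x) ^ 2 ≤ 1 :=
    (setLIntegral_mono' S.measurableSet_carrier fun x _ => pow_le_one' (hf1 _) 2).trans
      (by simpa using hm1)
  have hBD := sq_lintegral_le (volume.restrict S.carrier) (hf.comp measurable_inl)
  rw [Measure.restrict_apply_univ] at hBD
  simp only [Function.comp_apply] at hBD
  rw [lintegral_choiceLaw_const q S hf, lintegral_choiceLaw_const p S (hf.pow_const 2)]
  have hE := hf1 (Sum.inr ())
  generalize volume S.carrier = m at *
  generalize ∫⁻ x in S.carrier, f (Sum.inl x) = B at *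
  generalize ∫⁻ x in S.carrier, f (Sum.inl x) ^ 2 = D at *
  generalize f (Sum.inr ()) = E at *
  -- all quantities are finite, so that the inequality can be read in `ℝ`
  lift m to NNReal using ne_top_of_le_ne_top ENNReal.one_ne_top hm1
  lift B to NNReal using ne_top_of_le_ne_top ENNReal.one_ne_top hB1
  lift D to NNReal using ne_top_of_le_ne_top ENNReal.one_ne_top hD1
  lift E to NNReal using ne_top_of_le_ne_top ENNReal.one_ne_top hE
  have key := chiSq_real_bound (E := E) hc hp hq0.le m.coe_nonneg (by exact_mod_cast hm1)
    D.coe_nonneg (B := B) (by exact_mod_cast hBD)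
  have conv : ∀ r : ℝ, 0 < r → ∀ X Y : NNReal,
      (1 + ENNReal.ofReal r * (m : ℝ≥0∞))⁻¹ * (ENNReal.ofReal r * (X : ℝ≥0∞) + (Y : ℝ≥0∞))
        = ENNReal.ofReal ((r * X + Y) / (1 + r * m)) := by
    intro r hr X Y
    have h : 0 < 1 + r * (m : ℝ) := by positivity
    rw [div_eq_inv_mul, ENNReal.ofReal_mul (by positivity), ENNReal.ofReal_inv_of_pos h,
      ENNReal.ofReal_add zero_le_one (by positivity), ENNReal.ofReal_add (by positivity)
      Y.coe_nonneg, ENNReal.ofReal_mul hr.le, ENNReal.ofReal_mul hr.le]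
    simp
  rw [← ENNReal.coe_pow, conv q hq0, conv p hp0, ← ENNReal.ofReal_pow (by positivity),
    ← ENNReal.ofReal_mul (by positivity)]
  exact ENNReal.ofReal_le_ofReal (by exact_mod_cast key)

/-- The bound on `1 + χ²` multiplies along the periods, however the assortments adapt to the sales. -/
theorem chiSqBound_purchaseLaw {c p q : ℝ} (hc : 0 < c) (hp : c ≤ p) (hq : c ≤ q) (π : Policy)
    (t : ℕ) : ChiSqBound (purchaseLaw (fun _ => p) π t) (purchaseLaw (fun _ => q) π t)
      (ENNReal.ofReal (1 + (q - p) ^ 2 / c) ^ t) := by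
  induction t with
  | zero =>
    intro f hf _
    simp [purchaseLaw, lintegral_dirac' _ hf, lintegral_dirac' _ (hf.pow_const 2)]
  | succ t ih =>
    intro f hf hf1
    have hfs := hf.comp (measurable_snoc t)
    rw [lintegral_purchaseLaw_succ _ (lintegral_ofReal_const_ne_top q) π t hf,
      lintegral_purchaseLaw_succ _ (lintegral_ofReal_const_ne_top p) π t (hf.pow_const 2)]
    have hM := isMarkovKernel_choiceKernel (fun _ => q) (lintegral_ofReal_const_ne_top q)
    set κ := (choiceKernel fun _ => q).comap (π.offer t) (π.measurable_offer t)
    refine (ih _ (Measurable.lintegral_kernel_prod_right'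
      (κ := κ) hfs) fun x => ?_).trans ?_
    · calc _ ≤ ∫⁻ _, 1 ∂κ x := lintegral_mono fun z => hf1 _
        _ = 1 := by simp
    · rw [pow_succ (ENNReal.ofReal _), mul_assoc, ← lintegral_const_mul' _ _ ENNReal.ofReal_ne_top]
      gcongr with x
      exact chiSqBound_choiceLaw hc hp hq (π.offer t x) _
        (hfs.comp measurable_prodMk_left) fun z => hf1 _

/-- Le Cam's two-point bound: if `χ²(Q ‖ P) ≤ 1`, no event separates `P` from `Q`. -/
theorem ChiSqBound.half_le {Ω : Type*} [MeasurableSpace Ω] {P Q : Measure Ω}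
    [IsProbabilityMeasure P] [IsProbabilityMeasure Q] (h : ChiSqBound P Q 2) {A : Set Ω}
    (hA : MeasurableSet A) : 1 / 2 ≤ P.real A + Q.real Aᶜ := by
  have h1 := h (A.indicator fun _ => 1) (measurable_const.indicator hA)
    (fun x => indicator_le_self' (fun _ _ => zero_le_one) x)
  have h2 : ∀ x, (A.indicator (fun _ => (1 : ℝ≥0∞)) x) ^ 2 = A.indicator (fun _ => 1) x := by
    intro x
    by_cases hx : x ∈ A <;> simp [hx]
  simp only [h2, lintegral_indicator_const hA, one_mul] at h1
  have h3 : Q.real A ^ 2 ≤ 2 * P.real A := by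
    have := ENNReal.toReal_mono (by finiteness) h1
    simpa [Measure.real] using this
  rw [probReal_compl_eq_one_sub hA]
  nlinarith [sq_nonneg (Q.real A - 1)]

/-! ### Quadratic loss of a wrong threshold -/

theorem IsMarginalRevenue.exists_growth {w : ℝ → ℝ} (hw : IsMarginalRevenue w) :
    ∃ k > 0, ∀ x ∈ Icc (0 : ℝ) 1, ∀ y ∈ Icc (0 : ℝ) 1, x ≤ y → k * (y - x) ≤ w y - w x := by
  obtain ⟨k, hk, hkw⟩ := hw.deriv_pos
  refine ⟨k, hk, (convex_Icc 0 1).mul_sub_le_image_sub_of_le_deriv hw.continuousOn ?_ ?_⟩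
  · rw [interior_Icc]
    exact hw.contDiffOn.differentiableOn one_ne_zero
  · rwa [interior_Icc]

theorem continuous_coe_of_continuousOn {f : ℝ → ℝ} (hf : ContinuousOn f (Icc 0 1)) :
    Continuous fun x : I => f x :=
  continuousOn_iff_continuous_domRestrict.1 hf

theorem integrable_coe_of_continuousOn {f : ℝ → ℝ} (hf : ContinuousOn f (Icc 0 1)) :
    Integrable (fun x : I => f x) :=
  integrableOn_univ.1 ((continuous_coe_of_continuousOn hf).continuousOn.integrableOn_compact
    isCompact_univ)

theorem intervalIntegrable_of_mem {f : ℝ → ℝ} (hf : ContinuousOn f (Icc 0 1)) {a b : ℝ}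
    (ha : a ∈ Icc (0 : ℝ) 1) (hb : b ∈ Icc (0 : ℝ) 1) : IntervalIntegrable f volume a b :=
  (hf.mono (uIcc_subset_Icc ha hb)).intervalIntegrable

theorem setIntegral_coe_Ici (f : ℝ → ℝ) {z : ℝ} (hz : z ∈ Icc (0 : ℝ) 1) :
    ∫ x : I in {x : I | z ≤ x}, f x = ∫ x in z..1, f x := by
  have h := unitInterval.measurePreserving_coe.setIntegral_preimage_emb
    unitInterval.measurableEmbedding_coe f (Ici z)
  rw [Measure.restrict_restrict measurableSet_Ici] at h
  have h2 : Ici z ∩ I = Icc z 1 := by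
    ext x
    simp only [mem_inter_iff, mem_Ici, mem_Icc]
    exact ⟨fun h => ⟨h.1, h.2.2⟩, fun h => ⟨h.1, hz.1.trans h.1, h.2⟩⟩
  rw [h2, integral_Icc_eq_integral_Ioc, ← intervalIntegral.integral_of_le hz.2] at h
  exact h

theorem half_mul_sq_le_integral {w : ℝ → ℝ} (hc : ContinuousOn w (Icc 0 1)) {k : ℝ}
    (hw : ∀ x ∈ Icc (0 : ℝ) 1, ∀ y ∈ Icc (0 : ℝ) 1, x ≤ y → k * (y - x) ≤ w y - w x)
    {y z : ℝ} (hy : y ∈ Icc (0 : ℝ) 1) (hz : z ∈ Icc (0 : ℝ) 1) :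
    k / 2 * (z - y) ^ 2 ≤ ∫ x in y..z, (w x - w y) := by
  have hi : ∫ x in y..z, k * (x - y) = k / 2 * (z - y) ^ 2 := by
    rw [intervalIntegral.integral_const_mul, intervalIntegral.integral_comp_sub_right (fun x => x),
      integral_id]
    ring
  have hlin : ∀ a b, IntervalIntegrable (fun x => k * (x - y)) volume a b := fun a b =>
    Continuous.intervalIntegrable (by fun_prop) a b
  have hwi : ∀ {a b : ℝ}, a ∈ Icc (0 : ℝ) 1 → b ∈ Icc (0 : ℝ) 1 →
      IntervalIntegrable (fun x => w x - w y) volume a b := fun ha hb =>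
    intervalIntegrable_of_mem (hc.sub continuousOn_const) ha hb
  rw [← hi]
  rcases le_total y z with h | h
  · exact intervalIntegral.integral_mono_on h (hlin _ _) (hwi hy hz) fun x hx =>
      hw y hy x ⟨hy.1.trans hx.1, hx.2.trans hz.2⟩ hx.1
  · rw [intervalIntegral.integral_symm, intervalIntegral.integral_symm z y]
    refine neg_le_neg (intervalIntegral.integral_mono_on h (hwi hz hy) (hlin _ _) fun x hx => ?_)
    have := hw x ⟨hz.1.trans hx.1, hx.2.trans hy.2⟩ y hy hx.2
    linarith

/-- Rearrangement: among the assortments of volume `1 - z` the upper interval `[z, 1]` has the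
largest integral of the increasing function `w`. -/
theorem setIntegral_le_integral_of_growth {w : ℝ → ℝ} (hc : ContinuousOn w (Icc 0 1)) {k : ℝ}
    (hk : 0 < k)
    (hw : ∀ x ∈ Icc (0 : ℝ) 1, ∀ y ∈ Icc (0 : ℝ) 1, x ≤ y → k * (y - x) ≤ w y - w x)
    (S : Assortment) {z : ℝ} (hz : volume.real S.carrier = 1 - z) (c : ℝ) :
    ∫ x in S.carrier, (w x - c) ≤ ∫ x in z..1, (w x - c) := by
  have hz1 : z ∈ Icc (0 : ℝ) 1 := by
    have h1 : volume.real S.carrier ≤ 1 := measureReal_le_one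
    have h0 : 0 ≤ volume.real S.carrier := measureReal_nonneg
    constructor <;> linarith
  have hset : {x : I | 0 ≤ w x - w z} = {x : I | z ≤ x} := by
    ext x
    simp only [mem_ofPred_eq]
    constructor
    · intro h
      by_contra! hx
      have := hw x x.2 z hz1 hx.le
      nlinarith
    · intro h
      have := hw z hz1 x x.2 h
      nlinarith
  have hcont : ∀ c, ContinuousOn (fun x => w x - c) (Icc 0 1) := fun c =>
    hc.sub continuousOn_const
  have h1 : ∫ x in S.carrier, (w x - w z) ≤ ∫ x in z..1, (w x - w z) := by
    rw [← setIntegral_coe_Ici (fun x => w x - w z) hz1, ← hset]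
    exact setIntegral_le_nonneg S.measurableSet_carrier
      (continuous_coe_of_continuousOn (hcont _)).stronglyMeasurable
      (integrable_coe_of_continuousOn (hcont _))
  have h2 : ∫ x in S.carrier, (w x - c)
      = (∫ x in S.carrier, (w x - w z)) + (1 - z) * (w z - c) := by
    rw [← hz, ← smul_eq_mul, ← setIntegral_const,
      ← integral_add (integrable_coe_of_continuousOn (hcont _)).integrableOn (by simp)]
    simp
  have h3 : ∫ x in z..1, (w x - c) = (∫ x in z..1, (w x - w z)) + (1 - z) * (w z - c) := by
    rw [← smul_eq_mul, ← intervalIntegral.integral_const, ← intervalIntegral.integral_add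
      (intervalIntegrable_of_mem (hcont _) hz1 (by simp)) (by simp)]
    simp
  linarith

theorem revenue_const (w : ℝ → ℝ) (p : ℝ) (S : Assortment) : revenue w (fun _ => p) S
    = p * (∫ x in S.carrier, w x) / (1 + p * volume.real S.carrier) := by
  simp [revenue, integral_const_mul, mul_comm]

/-- If `[y, 1]` is the optimal assortment for the constant preference `p`, the revenue lost by
offering `S` is at least quadratic in the difference of the volumes of `S` and `[y, 1]`. -/
theorem sq_le_sub_revenue {w : ℝ → ℝ} (hc : ContinuousOn w (Icc 0 1)) {k : ℝ}
    (hk : 0 < k)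
    (hw : ∀ x ∈ Icc (0 : ℝ) 1, ∀ y ∈ Icc (0 : ℝ) 1, x ≤ y → k * (y - x) ≤ w y - w x)
    {c p y : ℝ} (hc0 : 0 < c) (hcp : c ≤ p) (hy : y ∈ Icc (0 : ℝ) 1)
    (hpy : p * ∫ x in y..1, (w x - w y) = w y) (S : Assortment) :
    c / (1 + c) * (k / 2) * (1 - volume.real S.carrier - y) ^ 2
      ≤ w y - revenue w (fun _ => p) S := by
  set s := volume.real S.carrier with hs
  have hs0 : 0 ≤ s := measureReal_nonneg
  have hs1 : s ≤ 1 := measureReal_le_one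
  have hp : 0 < p := hc0.trans_le hcp
  have hz : 1 - s ∈ Icc (0 : ℝ) 1 := ⟨by linarith, by linarith⟩
  have hcont : ContinuousOn (fun x => w x - w y) (Icc 0 1) := hc.sub continuousOn_const
  have h1 := setIntegral_le_integral_of_growth hc hk hw S (z := 1 - s) (by ring) (w y)
  have h2 := half_mul_sq_le_integral hc hw hy hz
  have h3 := intervalIntegral.integral_add_adjacent_intervals
    (intervalIntegrable_of_mem hcont hy hz)
    (intervalIntegrable_of_mem hcont hz (right_mem_Icc.2 zero_le_one))
  have h4 : ∫ x in S.carrier, (w x - w y) = (∫ x in S.carrier, w x) - s * w y := by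
    rw [integral_sub (integrable_coe_of_continuousOn hc).integrableOn (by simp),
      setIntegral_const, smul_eq_mul]
  have h5 : w y - revenue w (fun _ => p) S
      = p * ((∫ x in y..1, (w x - w y)) - ∫ x in S.carrier, (w x - w y)) / (1 + p * s) := by
    have : 1 + p * s ≠ 0 := by positivity
    rw [revenue_const, h4, ← hs, mul_sub, hpy]
    field_simp
    ring
  have h6 : c / (1 + c) ≤ p / (1 + p * s) := by
    rw [div_le_div_iff₀ (by positivity) (by positivity)]
    nlinarith [mul_nonneg (mul_nonneg hp.le hc0.le) (sub_nonneg.2 hs1)]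
  rw [h5, mul_div_right_comm, mul_assoc]
  gcongr
  linarith

/-! ### Bounds on revenue and regret -/

theorem integrable_coe_of_mem_prefClass {vmin vmax L : ℝ} {v : ℝ → ℝ} (hvmin : 0 < vmin)
    (hv : v ∈ prefClass vmin vmax L) : Integrable (fun x : I => v x) := by
  obtain ⟨hb, hd, -⟩ := hv
  have h1 : IntegrableOn v (Icc 0 1) := by
    rw [integrableOn_Icc_iff_integrableOn_Ioo]
    refine IntegrableOn.of_bound (by simp) (hd.continuousOn.aestronglyMeasurable
      measurableSet_Ioo) vmax ?_
    filter_upwards [ae_restrict_mem measurableSet_Ioo] with x hx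
    have := hb x (Ioo_subset_Icc_self hx)
    rw [Real.norm_of_nonneg (by linarith)]
    exact this.2
  exact (unitInterval.measurePreserving_coe.integrable_comp_emb
    unitInterval.measurableEmbedding_coe).2 h1

theorem revenue_mem_Icc {w : ℝ → ℝ} (hw : IsMarginalRevenue w) {vmin vmax L : ℝ}
    (hvmin : 0 < vmin) {v : ℝ → ℝ} (hv : v ∈ prefClass vmin vmax L) (S : Assortment) :
    revenue w v S ∈ Icc (0 : ℝ) 1 := by
  have hv0 : ∀ x : I, 0 ≤ v x := fun x => hvmin.le.trans (hv.1 x x.2).1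
  have hw0 : ∀ x : I, w x ∈ Icc (0 : ℝ) 1 := fun x => hw.mapsTo x.2
  have hd : 0 ≤ ∫ x in S.carrier, v x := integral_nonneg fun x => hv0 x
  have hn : 0 ≤ ∫ x in S.carrier, v x * w x :=
    integral_nonneg fun x => mul_nonneg (hv0 x) (hw0 x).1
  refine ⟨by unfold revenue; positivity, (div_le_one (by linarith)).2 ?_⟩
  have : ∫ x in S.carrier, v x * w x ≤ ∫ x in S.carrier, v x :=
    integral_mono_of_nonneg (.of_forall fun x => mul_nonneg (hv0 x) (hw0 x).1)
      (integrable_coe_of_mem_prefClass hvmin hv).integrableOn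
      (.of_forall fun x => mul_le_of_le_one_right (hv0 x) (hw0 x).2)
  linarith

theorem bddAbove_range_revenue {w : ℝ → ℝ} (hw : IsMarginalRevenue w) {vmin vmax L : ℝ}
    (hvmin : 0 < vmin) {v : ℝ → ℝ} (hv : v ∈ prefClass vmin vmax L) :
    BddAbove (range fun S : Assortment => revenue w v S) :=
  ⟨1, forall_mem_range.2 fun S => (revenue_mem_Icc hw hvmin hv S).2⟩

theorem optRevenue_mem_Icc {w : ℝ → ℝ} (hw : IsMarginalRevenue w) {vmin vmax L : ℝ}
    (hvmin : 0 < vmin) {v : ℝ → ℝ} (hv : v ∈ prefClass vmin vmax L) :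
    optRevenue w v ∈ Icc (0 : ℝ) 1 :=
  ⟨Real.iSup_nonneg fun S => (revenue_mem_Icc hw hvmin hv S).1,
    Real.iSup_le (fun S => (revenue_mem_Icc hw hvmin hv S).2) zero_le_one⟩

theorem const_mem_prefClass {vmin vmax L p : ℝ} (hL : 0 ≤ L) (hp : p ∈ Icc vmin vmax) :
    (fun _ => p) ∈ prefClass vmin vmax L :=
  ⟨fun _ _ => hp, differentiableOn_const p, fun y _ => by simpa using hL⟩

/-- The indifference equation `p ∫_y^1 (w - w y) = w y` says that `[y, 1]` earns `w y`. -/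
theorem le_optRevenue_const {w : ℝ → ℝ} (hw : IsMarginalRevenue w) {vmin vmax L p y : ℝ}
    (hvmin : 0 < vmin) (hL : 0 ≤ L) (hp : p ∈ Icc vmin vmax) (hy : y ∈ Icc (0 : ℝ) 1)
    (hpy : p * ∫ x in y..1, (w x - w y) = w y) : w y ≤ optRevenue w fun _ => p := by
  have hp0 : 0 < p := hvmin.trans_le hp.1
  refine le_ciSup_of_le (bddAbove_range_revenue hw hvmin (const_mem_prefClass hL hp))
    ⟨{x : I | y ≤ x}, measurableSet_le measurable_const measurable_subtype_coe⟩ (le_of_eq ?_)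
  have h1 : volume.real {x : I | y ≤ x} = 1 - y := by
    have := setIntegral_coe_Ici (fun _ => 1) hy
    simpa using this
  have h2 : 1 + p * (1 - y) ≠ 0 := by
    have := sub_nonneg.2 hy.2
    positivity
  rw [intervalIntegral.integral_sub (intervalIntegrable_of_mem hw.continuousOn hy (by simp))
    (by simp), intervalIntegral.integral_const, smul_eq_mul] at hpy
  rw [revenue_const]
  simp only [h1, setIntegral_coe_Ici w hy]
  field_simp
  linarith

theorem regret_le {w : ℝ → ℝ} (hw : IsMarginalRevenue w) {vmin vmax L : ℝ}
    (hvmin : 0 < vmin) {v : ℝ → ℝ} (hv : v ∈ prefClass vmin vmax L) (π : Policy) (T : ℕ) :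
    regret w π T v ≤ T := by
  have hvi : ∫⁻ x : I, ENNReal.ofReal (v x) ≠ ∞ :=
    (integrable_coe_of_mem_prefClass hvmin hv).lintegral_lt_top.ne
  have h : ∀ t ∈ Finset.range T,
      ∫ x, (optRevenue w v - revenue w v (π.offer t x)) ∂(purchaseLaw v π t) ≤ 1 := by
    intro t _
    have := isProbabilityMeasure_purchaseLaw v hvi π t
    have h1 := norm_integral_le_of_norm_le_const (μ := purchaseLaw v π t) (C := 1)
      (f := fun x => optRevenue w v - revenue w v (π.offer t x)) (.of_forall fun x => by
        have h1 := optRevenue_mem_Icc hw hvmin hv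
        have h2 := revenue_mem_Icc hw hvmin hv (π.offer t x)
        rw [Real.norm_eq_abs, abs_le]
        constructor <;> linarith [h1.1, h1.2, h2.1, h2.2])
    rw [probReal_univ, mul_one] at h1
    exact (le_abs_self _).trans h1
  calc regret w π T v ≤ ∑ t ∈ Finset.range T, (1 : ℝ) := Finset.sum_le_sum h
    _ = T := by simp

theorem regret_le_worstCaseRegret {w : ℝ → ℝ} (hw : IsMarginalRevenue w) {vmin vmax L : ℝ}
    (hvmin : 0 < vmin) {v : ℝ → ℝ} (hv : v ∈ prefClass vmin vmax L) (π : Policy) (T : ℕ) :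
    regret w π T v ≤ worstCaseRegret w (prefClass vmin vmax L) π T :=
  le_ciSup (f := fun v : prefClass vmin vmax L => regret w π T v)
    ⟨(T : ℝ), forall_mem_range.2 fun v => regret_le hw hvmin v.2 π T⟩ ⟨v, hv⟩

theorem measurable_volume_real : Measurable fun S : Assortment => volume.real S.carrier := by
  simpa [Measure.real] using (measurable_volume_inter MeasurableSet.univ).ennreal_toReal

theorem measurable_revenue_const {w : ℝ → ℝ} (hw : IsMarginalRevenue w) (p : ℝ) :
    Measurable fun S : Assortment => revenue w (fun _ => p) S := by
  have h : ∀ S : Assortment, ∫ x in S.carrier, w x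
      = (∫⁻ x in S.carrier, ENNReal.ofReal (w x)).toReal := fun S =>
    integral_eq_lintegral_of_nonneg_ae (.of_forall fun x => (hw.mapsTo x.2).1)
      (continuous_coe_of_continuousOn hw.continuousOn).aestronglyMeasurable
  simp_rw [revenue_const, h]
  exact ((measurable_setLIntegral _).ennreal_toReal.const_mul p).div
    ((measurable_volume_real.const_mul p).const_add 1)

/-- The expected regret in period `t + 1` of the policy `π` under the constant preference `p`. -/
noncomputable def periodRegret (w : ℝ → ℝ) (π : Policy) (t : ℕ) (p : ℝ) : ℝ :=
  ∫ x, (optRevenue w (fun _ => p) - revenue w (fun _ => p) (π.offer t x))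
    ∂(purchaseLaw (fun _ => p) π t)

/-- Markov's inequality for the quadratic lower bound on the regret: the estimate
`1 - vol S` of the optimal threshold `y` is rarely far from `y` if the expected regret is small. -/
theorem mul_measureReal_le_periodRegret {w : ℝ → ℝ} (hw : IsMarginalRevenue w) {k : ℝ} (hk : 0 < k)
    (hwk : ∀ x ∈ Icc (0 : ℝ) 1, ∀ y ∈ Icc (0 : ℝ) 1, x ≤ y → k * (y - x) ≤ w y - w x)
    {vmin vmax L p y d : ℝ} (hvmin : 0 < vmin) (hL : 0 ≤ L) (hp : p ∈ Icc vmin vmax)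
    (hy : y ∈ Icc (0 : ℝ) 1) (hpy : p * ∫ x in y..1, (w x - w y) = w y) (hd : 0 ≤ d) (π : Policy)
    (t : ℕ) {A : Set (Fin t → Purchase)}
    (hA : ∀ x ∈ A, d ≤ |1 - volume.real (π.offer t x).carrier - y|) :
    vmin / (1 + vmin) * (k / 2) * d ^ 2 * (purchaseLaw (fun _ => p) π t).real A
      ≤ periodRegret w π t p := by
  have := isProbabilityMeasure_purchaseLaw (fun _ => p) (lintegral_ofReal_const_ne_top p) π t
  have hmem := const_mem_prefClass (vmin := vmin) (vmax := vmax) hL hp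
  have hlow : ∀ x, vmin / (1 + vmin) * (k / 2) * (1 - volume.real (π.offer t x).carrier - y) ^ 2
      ≤ optRevenue w (fun _ => p) - revenue w (fun _ => p) (π.offer t x) := fun x =>
    (sq_le_sub_revenue hw.continuousOn hk hwk hvmin hp.1 hy hpy _).trans
      (sub_le_sub_right (le_optRevenue_const hw hvmin hL hp hy hpy) _)
  have hint : Integrable (fun x => optRevenue w (fun _ => p)
      - revenue w (fun _ => p) (π.offer t x)) (purchaseLaw (fun _ => p) π t) := by
    refine (integrable_const _).sub (Integrable.of_bound (C := 1)
      ((measurable_revenue_const hw p).comp (π.measurable_offer t)).aestronglyMeasurable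
      (.of_forall fun x => ?_))
    have h := revenue_mem_Icc hw hvmin hmem (π.offer t x)
    rw [Real.norm_of_nonneg h.1]
    exact h.2
  refine le_trans ?_ (mul_meas_ge_le_integral_of_nonneg (.of_forall fun x => ?_) hint
    (vmin / (1 + vmin) * (k / 2) * d ^ 2))
  · refine mul_le_mul_of_nonneg_left (measureReal_mono fun x hx => ?_) (by positivity)
    refine le_trans ?_ (hlow x)
    rw [← sq_abs (1 - _ - y)]
    gcongr
    exact hA x hx
  · exact le_trans (by positivity) (hlow x)

/-! ### Two indistinguishable preferences -/

theorem periodRegret_nonneg {w : ℝ → ℝ} (hw : IsMarginalRevenue w)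
    {vmin vmax L p : ℝ} (hvmin : 0 < vmin) (hL : 0 ≤ L) (hp : p ∈ Icc vmin vmax)
    (π : Policy) (t : ℕ) : 0 ≤ periodRegret w π t p :=
  integral_nonneg fun _ => sub_nonneg.2
    (le_ciSup (bddAbove_range_revenue hw hvmin (const_mem_prefClass (L := L) hL hp)) _)

/-- Two preferences with optimal thresholds at distance `δ` that cannot be told apart from `t`
sales force a total regret of order `δ²` in period `t + 1`. -/
theorem sq_le_periodRegret_add {w : ℝ → ℝ} (hw : IsMarginalRevenue w) {k : ℝ} (hk : 0 < k)
    (hwk : ∀ x ∈ Icc (0 : ℝ) 1, ∀ y ∈ Icc (0 : ℝ) 1, x ≤ y → k * (y - x) ≤ w y - w x)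
    {vmin vmax L p q y z : ℝ} (hvmin : 0 < vmin) (hL : 0 ≤ L) (hp : p ∈ Icc vmin vmax)
    (hq : q ∈ Icc vmin vmax) (hy : y ∈ Icc (0 : ℝ) 1) (hz : z ∈ Icc (0 : ℝ) 1)
    (hpy : p * ∫ x in y..1, (w x - w y) = w y) (hqz : q * ∫ x in z..1, (w x - w z) = w z)
    (hyz : y ≤ z) (π : Policy) (t : ℕ) (ht : t * ((q - p) ^ 2 / vmin) ≤ 1 / 2) :
    vmin / (1 + vmin) * (k / 2) * (z - y) ^ 2 / 8
      ≤ periodRegret w π t p + periodRegret w π t q := by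
  have := isProbabilityMeasure_purchaseLaw (fun _ => p) (lintegral_ofReal_const_ne_top p) π t
  have := isProbabilityMeasure_purchaseLaw (fun _ => q) (lintegral_ofReal_const_ne_top q) π t
  set A : Set (Fin t → Purchase) :=
    {x | (y + z) / 2 ≤ 1 - volume.real (π.offer t x).carrier} with hAdef
  have hA : MeasurableSet A := measurableSet_le measurable_const
    ((measurable_volume_real.comp (π.measurable_offer t)).const_sub 1)
  have hu : 0 ≤ (q - p) ^ 2 / vmin := by positivity
  have hpow : (1 + (q - p) ^ 2 / vmin) ^ t ≤ 2 := by
    calc (1 + (q - p) ^ 2 / vmin) ^ t ≤ Real.exp ((q - p) ^ 2 / vmin) ^ t := by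
          gcongr
          rw [add_comm]
          exact Real.add_one_le_exp _
      _ = Real.exp (t * ((q - p) ^ 2 / vmin)) := (Real.exp_nat_mul _ _).symm
      _ ≤ Real.exp (1 / 2) := Real.exp_le_exp.2 ht
      _ ≤ 1 / (1 - 1 / 2) := Real.exp_bound_div_one_sub_of_interval (by norm_num) (by norm_num)
      _ = 2 := by norm_num
  have hchi : ChiSqBound (purchaseLaw (fun _ => p) π t) (purchaseLaw (fun _ => q) π t) 2 := by
    intro f hf hf1
    refine (chiSqBound_purchaseLaw hvmin hp.1 hq.1 π t f hf hf1).trans ?_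
    gcongr
    rw [← ENNReal.ofReal_pow (by positivity)]
    exact (ENNReal.ofReal_le_ofReal hpow).trans (by simp)
  have h1 := mul_measureReal_le_periodRegret hw hk hwk hvmin hL hp hy hpy (d := (z - y) / 2)
    (by linarith) π t (A := A) fun x hx => by
      have : (y + z) / 2 ≤ 1 - volume.real (π.offer t x).carrier := hx
      refine le_trans ?_ (le_abs_self _)
      linarith
  have h2 := mul_measureReal_le_periodRegret hw hk hwk hvmin hL hq hz hqz (d := (z - y) / 2)
    (by linarith) π t (A := Aᶜ) fun x hx => by
      have : ¬ (y + z) / 2 ≤ 1 - volume.real (π.offer t x).carrier := hx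
      refine le_trans ?_ (neg_le_abs _)
      linarith
  have h3 := hchi.half_le hA
  calc vmin / (1 + vmin) * (k / 2) * (z - y) ^ 2 / 8
      = vmin / (1 + vmin) * (k / 2) * ((z - y) / 2) ^ 2 * (1 / 2) := by ring
    _ ≤ vmin / (1 + vmin) * (k / 2) * ((z - y) / 2) ^ 2
          * ((purchaseLaw (fun _ => p) π t).real A + (purchaseLaw (fun _ => q) π t).real Aᶜ) := by
        gcongr
    _ ≤ _ := by
        rw [mul_add]
        exact add_le_add h1 h2

/-- A lower bound on all pairs at distance `d` is a lower bound on the average. -/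
theorem mul_le_sum_of_le_add_shift {F : ℕ → ℝ} {N d : ℕ} {e : ℝ} (he : 0 ≤ e)
    (hF : ∀ j < N, 0 ≤ F j) (hd : 2 * d ≤ N) (h : ∀ j, j + d < N → e ≤ F j + F (j + d)) :
    N * e / 4 ≤ ∑ j ∈ Finset.range N, F j := by
  have h1 : ∑ j ∈ Finset.range (N - d), F j ≤ ∑ j ∈ Finset.range N, F j :=
    Finset.sum_le_sum_of_subset_of_nonneg (by simp) fun j hj _ => hF j (Finset.mem_range.1 hj)
  have h2 : ∑ j ∈ Finset.range (N - d), F (j + d) ≤ ∑ j ∈ Finset.range N, F j := by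
    have h3 : ∑ j ∈ Finset.range (N - d), F (j + d) = ∑ j ∈ Finset.Ico d N, F j := by
      rw [Finset.sum_Ico_eq_sum_range]
      simp_rw [add_comm d]
    rw [h3]
    exact Finset.sum_le_sum_of_subset_of_nonneg
      (fun j hj => Finset.mem_range.2 (Finset.mem_Ico.1 hj).2)
      fun j hj _ => hF j (Finset.mem_range.1 hj)
  have h4 : ((N - d : ℕ) : ℝ) * e
      ≤ ∑ j ∈ Finset.range (N - d), F j + ∑ j ∈ Finset.range (N - d), F (j + d) := by
    rw [← Finset.sum_add_distrib, ← nsmul_eq_mul, ← Finset.card_range (N - d),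
      Finset.card_range (N - d)]
    refine (Finset.range (N - d)).card_nsmul_le_sum _ _ (fun j hj => h j ?_) |>.trans' ?_
    · have := Finset.mem_range.1 hj
      omega
    · rw [Finset.card_range]
  rw [Nat.cast_sub (by omega)] at h4
  have h5 : (2 : ℝ) * d ≤ N := by exact_mod_cast hd
  nlinarith

/-! ### A curve of constant preferences -/

/-- The preferences under which a threshold `y` is optimal form a curve: near a suitable interior
point, `y ↦ w y / ∫_y^1 (w - w y)` is Lipschitz with values in `[vmin, vmax]`. -/
theorem exists_lipschitz_threshold_curve {w : ℝ → ℝ} (hw : IsMarginalRevenue w) {k : ℝ} (hk : 0 < k)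
    (hwk : ∀ x ∈ Icc (0 : ℝ) 1, ∀ y ∈ Icc (0 : ℝ) 1, x ≤ y → k * (y - x) ≤ w y - w x)
    {vmin vmax : ℝ} (hv : vmin < vmax)
    (hvmax : w 0 / (∫ x in (0 : ℝ)..1, (w x - w 0)) < vmax) :
    ∃ (θ : ℝ → ℝ) (a l : ℝ) (K : NNReal), 0 < l ∧ Icc a (a + l) ⊆ Icc 0 1 ∧
      LipschitzOnWith K θ (Icc a (a + l)) ∧ MapsTo θ (Icc a (a + l)) (Icc vmin vmax) ∧
      ∀ y ∈ Icc a (a + l), θ y * ∫ x in y..1, (w x - w y) = w y := by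
  have hc := hw.continuousOn
  have h01 : (0 : ℝ) ∈ Icc (0 : ℝ) 1 := by simp
  have h11 : (1 : ℝ) ∈ Icc (0 : ℝ) 1 := by simp
  have hGpos : ∀ y ∈ Icc (0 : ℝ) 1, y < 1 → 0 < ∫ x in y..1, (w x - w y) := fun y hy hy1 =>
    lt_of_lt_of_le (mul_pos (half_pos hk) (pow_pos (sub_pos.2 hy1) 2))
      (half_mul_sq_le_integral hc hwk hy h11)
  have hG : ∀ y ∈ Icc (0 : ℝ) 1,
      ∫ x in y..1, (w x - w y) = (∫ x in y..1, w x) - (1 - y) * w y := by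
    intro y hy
    rw [intervalIntegral.integral_sub (intervalIntegrable_of_mem hc hy h11) (by simp),
      intervalIntegral.integral_const, smul_eq_mul]
  -- a preference strictly inside the admissible range whose optimal threshold is interior
  obtain ⟨τ, hτ1, hτ2⟩ := exists_between (max_lt hv hvmax)
  have hτmin : vmin < τ := (le_max_left _ _).trans_lt hτ1
  have hτ0 : w 0 < τ * ((∫ x in (0 : ℝ)..1, w x) - (1 - 0) * w 0) := by
    rw [← hG 0 h01]
    exact (div_lt_iff₀ (hGpos 0 h01 zero_lt_one)).1 ((le_max_right _ _).trans_lt hτ1)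
  have hw1 : 0 < w 1 := by
    have h1 := hwk 0 h01 1 h11 zero_le_one
    have h2 := (hw.mapsTo h01).1
    linarith
  have hcI : ContinuousOn (fun y => ∫ x in y..1, w x) (Icc 0 1) := by
    have := intervalIntegral.continuousOn_primitive_interval_left (f := w) (μ := volume)
      (a := 0) (b := 1) (by rw [uIcc_of_le zero_le_one]; exact hc.integrableOn_Icc)
    rwa [uIcc_of_le zero_le_one] at this
  obtain ⟨y₀, hy₀, hy₀eq⟩ := intermediate_value_Ioo' (zero_le_one (α := ℝ))
    (f := fun y => τ * ((∫ x in y..1, w x) - (1 - y) * w y) - w y)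
    ((continuousOn_const.mul (hcI.sub ((continuousOn_const.sub continuousOn_id).mul hc))).sub hc)
    (show (0 : ℝ) ∈ Ioo _ _ by
      constructor
      · simpa using hw1
      · linarith)
  have hnhds : Icc (0 : ℝ) 1 ∈ nhds y₀ := Icc_mem_nhds hy₀.1 hy₀.2
  have hG₀ : 0 < (∫ x in y₀..1, w x) - (1 - y₀) * w y₀ := by
    rw [← hG y₀ (Ioo_subset_Icc_self hy₀)]
    exact hGpos y₀ (Ioo_subset_Icc_self hy₀) hy₀.2
  set θ : ℝ → ℝ := fun y => w y / ((∫ x in y..1, w x) - (1 - y) * w y) with hθ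
  have hθ₀ : θ y₀ = τ := by
    rw [hθ]
    simp only [] at hy₀eq ⊢
    rw [div_eq_iff hG₀.ne']
    linarith
  have hdw : HasStrictDerivAt w (deriv w y₀) y₀ :=
    (hw.contDiffOn.contDiffAt (Ioo_mem_nhds hy₀.1 hy₀.2)).hasStrictDerivAt one_ne_zero
  have hdI : HasStrictDerivAt (fun y => ∫ x in y..1, w x) (-w y₀) y₀ :=
    intervalIntegral.integral_hasStrictDerivAt_left
      (intervalIntegrable_of_mem hc (Ioo_subset_Icc_self hy₀) h11)
      ⟨_, hnhds, hc.aestronglyMeasurable measurableSet_Icc⟩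
      (hc.continuousAt hnhds)
  have hdθ := hdw.div (hdI.sub (((hasStrictDerivAt_id y₀).const_sub 1).mul hdw)) hG₀.ne'
  obtain ⟨K, s, hs, hK⟩ := hdθ.hasStrictFDerivAt.exists_lipschitzOnWith
  have hcθ : ContinuousAt θ y₀ := hdθ.hasDerivAt.continuousAt
  have hmem : s ∩ θ ⁻¹' Icc vmin vmax ∩ Ioo 0 1 ∈ nhds y₀ :=
    Filter.inter_mem (Filter.inter_mem hs (hcθ.preimage_mem_nhds
      (by rw [hθ₀]; exact Icc_mem_nhds hτmin hτ2))) (Ioo_mem_nhds hy₀.1 hy₀.2)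
  obtain ⟨ε, hε, hball⟩ := Metric.mem_nhds_iff.1 hmem
  have hsub : Icc y₀ (y₀ + ε / 2) ⊆ s ∩ θ ⁻¹' Icc vmin vmax ∩ Ioo 0 1 := fun y hy => hball (by
    rw [Metric.mem_ball, Real.dist_eq, abs_lt]
    constructor <;> linarith [hy.1, hy.2])
  refine ⟨θ, y₀, ε / 2, K, by linarith, fun y hy => Ioo_subset_Icc_self (hsub hy).2,
    hK.mono fun y hy => (hsub hy).1.1, fun y hy => (hsub hy).1.2, fun y hy => ?_⟩
  have hy' := (hsub hy).2
  have hpos := hGpos y (Ioo_subset_Icc_self hy') hy'.2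
  rw [hG y (Ioo_subset_Icc_self hy')] at hpos ⊢
  exact div_mul_cancel₀ _ hpos.ne'

/-! ### The logarithmic lower bound -/

theorem log_le_sum_inv (T : ℕ) (hT : 1 ≤ T) :
    Real.log T ≤ ∑ t ∈ Finset.range T, ((t : ℝ) + 1)⁻¹ := by
  have h := log_add_one_le_harmonic T
  have h2 : Real.log T ≤ Real.log (T + 1 : ℕ) :=
    Real.log_le_log (by exact_mod_cast hT) (by exact_mod_cast Nat.le_succ T)
  refine h2.trans (h.trans (le_of_eq ?_))
  simp [harmonic]


end ContinuousAssortment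

theorem theorem2 (w : ℝ → ℝ) (hw : IsMarginalRevenue w)
    (vmin vmax L : ℝ) (hvmin : 0 < vmin) (hv : vmin < vmax) (hL : 0 ≤ L)
    (hvmax : w 0 / (∫ x in (0 : ℝ)..1, (w x - w 0)) < vmax) :
    ∃ C : ℝ, 0 < C ∧ ∀ (π : Policy) (T : ℕ), 2 ≤ T →
      C * Real.log T ≤ worstCaseRegret w (prefClass vmin vmax L) π T := by
  obtain ⟨k, hk, hwk⟩ := hw.exists_growth
  obtain ⟨θ, a, l, K, hl, hsub, hLip, hmaps, hbal⟩ :=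
    exists_lipschitz_threshold_curve hw hk hwk hv hvmax
  obtain ⟨M, hM⟩ := exists_nat_ge (max 2 (2 * (K ^ 2 * l ^ 2 / vmin)))
  have hM2 : (2 : ℝ) ≤ M := (le_max_left _ _).trans hM
  have hMK : 2 * (K ^ 2 * l ^ 2 / vmin) ≤ (M : ℝ) := (le_max_right _ _).trans hM
  have hM0 : (0 : ℝ) < M := by linarith
  set c := vmin / (1 + vmin) * (k / 2) with hc
  have hc0 : 0 < c := by positivity
  refine ⟨c * l ^ 2 / (128 * M ^ 2), by positivity, fun π T hT => ?_⟩
  have hT0 : (0 : ℝ) < T := by exact_mod_cast (by omega : 0 < T)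
  -- the prior: the uniform distribution on a grid of `N` thresholds in `[a, a + l)`
  set N := M * T with hN
  have hNR : (N : ℝ) = M * T := by rw [hN]; push_cast; ring
  have hN0 : (0 : ℝ) < N := by rw [hNR]; positivity
  set y : ℕ → ℝ := fun j => a + j * (l / N) with hy
  have hymem : ∀ j < N, y j ∈ Icc a (a + l) := by
    intro j hj
    have h1 : (j : ℝ) ≤ N := by exact_mod_cast hj.le
    have h2 : j * (l / N) ≤ l := by
      rw [mul_div_assoc', div_le_iff₀ hN0]
      nlinarith
    have h3 : 0 ≤ j * (l / N) := by positivity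
    exact ⟨by simp only [hy]; linarith, by simp only [hy]; linarith⟩
  have hperiod : ∀ t ∈ Finset.range T, N * (c * l ^ 2 / (32 * M ^ 2) * ((t : ℝ) + 1)⁻¹) / 4
      ≤ ∑ j ∈ Finset.range N, periodRegret w π t (θ (y j)) := by
    intro t ht
    have htT : (t : ℝ) + 1 ≤ T := by exact_mod_cast Finset.mem_range.1 ht
    set r := √((t : ℝ) + 1) with hr
    have hr2 : r ^ 2 = (t : ℝ) + 1 := Real.sq_sqrt (by positivity)
    have hr1 : 1 ≤ r := Real.one_le_sqrt.2 (by linarith [Nat.cast_nonneg (α := ℝ) t])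
    have hrT : r ≤ T := by nlinarith
    have hr0 : 0 < r := by linarith
    -- thresholds at distance of order `1 / √(t + 1)` are indistinguishable after `t` periods
    set d := ⌊(T : ℝ) / r⌋₊ with hd
    have hdu : (d : ℝ) ≤ T / r := Nat.floor_le (by positivity)
    have hd1 : 1 ≤ (T : ℝ) / r := (one_le_div hr0).2 hrT
    have hdl : T / r / 2 ≤ (d : ℝ) := by
      have h1 : (T : ℝ) / r < d + 1 := Nat.lt_floor_add_one _
      have h2 : (1 : ℝ) ≤ d := by exact_mod_cast (Nat.one_le_floor_iff _).2 hd1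
      linarith
    have hδu : d * (l / N) ≤ l / (M * r) := by
      calc d * (l / N) ≤ T / r * (l / N) := by gcongr
        _ = l / (M * r) := by rw [hNR]; field_simp
    have hδl : l / (M * r) / 2 ≤ d * (l / N) := by
      calc l / (M * r) / 2 = T / r / 2 * (l / N) := by rw [hNR]; field_simp
        _ ≤ d * (l / N) := by gcongr
    refine mul_le_sum_of_le_add_shift (by positivity)
      (fun j hj => periodRegret_nonneg hw hvmin hL (hmaps (hymem j hj)) π t) (d := d) ?_ ?_
    · have h1 : (d : ℝ) ≤ T := hdu.trans (div_le_self hT0.le hr1)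
      have h2 : (2 : ℝ) * d ≤ N := by rw [hNR]; nlinarith
      exact_mod_cast h2
    · intro j hj
      have hj1 := hymem j (by omega)
      have hj2 := hymem (j + d) hj
      have hδ : y (j + d) - y j = d * (l / N) := by simp only [hy]; push_cast; ring
      have hδ0 : 0 ≤ d * (l / N) := by positivity
      refine le_trans ?_ (sq_le_periodRegret_add hw hk hwk hvmin hL (hmaps hj1) (hmaps hj2)
        (hsub hj1) (hsub hj2) (hbal _ hj1) (hbal _ hj2) (by linarith) π t ?_)
      · rw [hδ, ← hc]
        calc c * l ^ 2 / (32 * M ^ 2) * ((t : ℝ) + 1)⁻¹ = c * (l / (M * r) / 2) ^ 2 / 8 := by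
              rw [← hr2]; field_simp; norm_num
          _ ≤ _ := by gcongr
      · have h1 : |θ (y (j + d)) - θ (y j)| ≤ K * (l / (M * r)) := by
          have h := hLip.dist_le_mul _ hj2 _ hj1
          rw [Real.dist_eq, Real.dist_eq, hδ, abs_of_nonneg hδ0] at h
          exact h.trans (by gcongr)
        rw [← sq_abs]
        calc (t : ℝ) * (|θ (y (j + d)) - θ (y j)| ^ 2 / vmin)
            ≤ r ^ 2 * ((K * (l / (M * r))) ^ 2 / vmin) := by
              gcongr
              linarith
          _ = K ^ 2 * l ^ 2 / vmin / M ^ 2 := by field_simp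
          _ ≤ 1 / 2 := by
              rw [div_le_iff₀ (by positivity)]
              nlinarith
  have hsum : ∑ j ∈ Finset.range N, regret w π T (fun _ => θ (y j))
      ≤ N * worstCaseRegret w (prefClass vmin vmax L) π T := by
    refine (Finset.sum_le_card_nsmul _ _ (worstCaseRegret w (prefClass vmin vmax L) π T)
      fun j hj => regret_le_worstCaseRegret hw hvmin
        (const_mem_prefClass hL (hmaps (hymem j (Finset.mem_range.1 hj)))) π T).trans ?_
    simp
  have hswap : ∑ j ∈ Finset.range N, regret w π T (fun _ => θ (y j))
      = ∑ t ∈ Finset.range T, ∑ j ∈ Finset.range N, periodRegret w π t (θ (y j)) :=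
    Finset.sum_comm
  refine le_of_mul_le_mul_left ?_ hN0
  calc N * (c * l ^ 2 / (128 * M ^ 2) * Real.log T)
      ≤ N * (c * l ^ 2 / (128 * M ^ 2) * ∑ t ∈ Finset.range T, ((t : ℝ) + 1)⁻¹) := by
        gcongr
        exact log_le_sum_inv T (by omega)
    _ = ∑ t ∈ Finset.range T, N * (c * l ^ 2 / (32 * M ^ 2) * ((t : ℝ) + 1)⁻¹) / 4 := by
        rw [Finset.mul_sum, Finset.mul_sum]
        refine Finset.sum_congr rfl fun t _ => ?_
        field_simp
        norm_num
    _ ≤ _ := Finset.sum_le_sum hperiod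
    _ = _ := hswap.symm
    _ ≤ _ := hsum
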